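/- Let $T>0$, $\beta>0$, let $\Omega\subset\mathbb R^d$ be a bounded open set, $U\subseteq\Omega$ open, and $U_1,U_2\subseteq U$ disjoint open sets with $|U\setminus(U_1\cup U_2)|=0$. Let $a\colon[0,\infty)\times\mathbb R^d\to\mathcal S_d$ and $\mu\colon[0,\infty)\times\mathbb R^d\to\mathbb R^d$ be Lipschitz, with $\mathcal S_d$ the real symmetric $d\times d$ matrices and $a(t,x)\succeq\lambda I$ for all $(t,x)$ and some $\lambda>0$. Put $\mathcal L_{t,x}=\tfrac12\operatorname{tr}\{a(t,x)D_x^2\}+\mu(t,x)\cdot\nabla_x$, let $\mathcal L^*_{t,x}$ be its formal adjoint, and let $\varepsilon\in\{1,-1\}$ (for $\varepsilon=-1$ the state equation below is forward parabolic). Let $y^{r_f}\in L^2((0,T)\times\Omega)$ and $u_1\in L^2((0,T)\times U_1)$ be given; $\chi_S$ is the characteristic function of $S$. For $u_2\in L^2((0,T)\times U_2)$, a state of $(u_1,u_2)$ is a weak solution $y\in L^2(0,T;H^1_0(\Omega))$ of $$\frac{\partial y}{\partial t}+\varepsilon\mathcal L_{t,x}y=u_1\chi_{U_1}+u_2\chi_{U_2}\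 \text{ in }(0,T)\times\Omega,\qquad y(0,\cdot)=0,\qquad y=0\ \text{ on }(0,T)\times\partial\Omega,$$ and its cost is $$J_2=\frac12\iint_{(0,T)\times\Omega}(y-y^{r_f})^2\,dx\,dt+\frac\beta2\iint_{(0,T)\times U}(u_1\chi_{U_1}+u_2\chi_{U_2})^2\,dx\,dt .$$ Suppose that the coupled system $$\frac{\partial y}{\partial t}+\varepsilon\mathcal L_{t,x}y=u_1\chi_{U_1}-\frac1\beta\,p\,\chi_{U_2},\qquad -\frac{\partial p}{\partial t}+\varepsilon\mathcal L_{t,x}^*p=y-y^{r_f}\quad\text{in }(0,T)\times\Omega,$$ $$y(0,\cdot)=0,\qquad p(T,\cdot)=0,\qquad y=p=0\ \text{ on }(0,T)\times\partial\Omega,$$ has a unique weak solution $(y(u_1),p(u_1))$ with $y,p\in L^2(0,T;H^1_0(\Omega))$. Then $$u_2^*=\digamma(u_1)=-\frac1\beta\,p(u_1)\,\chi_{U_2}$$ is the follower's optimal response to $u_1$: it belongs to $L^2((0,T)\times U_2)$, $y(u_1)$ is a state of $(u_1,u_2^*)$, $u_2^*$ minimizes $J_2$ over all $u_2\in L^2((0,T)\times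 U_2)$ for which $(u_1,u_2)$ has a state, and it is the only such minimizer (up to equality almost everywhere). -/

import Mathlib

open MeasureTheory Set Filter
open scoped ContDiff ENNReal

noncomputable section

namespace Follower

/-- Space `ℝ^d` with its Euclidean norm. -/
abbrev Space (d : ℕ) : Type := EuclideanSpace ℝ (Fin d)

/-- The space-time cylinder `(0,T) × S`. -/
def cyl {d : ℕ} (T : ℝ) (S : Set (Space d)) : Set (ℝ × Space d) := Ioo 0 T ×ˢ S

/-- Test functions on `Ω`: smooth functions with compact support contained in `Ω`. -/
structure IsTest {d : ℕ} (Ω : Set (Space d)) (φ : Space d → ℝ) : Prop where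
  smooth : ContDiff ℝ ∞ φ
  compact : HasCompactSupport φ
  support : tsupport φ ⊆ Ω

/-- `v ∈ H¹₀(Ω)` with weak gradient `Dv`: the pair `(v, Dv)` lies in the closure of
`{(φ, ∇φ) : φ ∈ C_c^∞(Ω)}` in `L²(Ω) × L²(Ω; ℝ^d)`. -/
structure MemH10 {d : ℕ} (Ω : Set (Space d)) (v : Space d → ℝ) (Dv : Space d → Space d) :
    Prop where
  memLp : MemLp v 2 (volume.restrict Ω)
  memLp_grad : MemLp Dv 2 (volume.restrict Ω)
  approx : ∀ δ : ℝ≥0∞, 0 < δ → ∃ φ : Space d → ℝ, IsTest Ω φ ∧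
    eLpNorm (fun x => v x - φ x) 2 (volume.restrict Ω) < δ ∧
    eLpNorm (fun x => Dv x - gradient φ x) 2 (volume.restrict Ω) < δ

/-- `y ∈ L²(0,T; H¹₀(Ω))` with weak spatial gradient `Dy`. -/
structure MemL2H10 {d : ℕ} (T : ℝ) (Ω : Set (Space d))
    (y : ℝ × Space d → ℝ) (Dy : ℝ × Space d → Space d) : Prop where
  memLp : MemLp y 2 (volume.restrict (cyl T Ω))
  memLp_grad : MemLp Dy 2 (volume.restrict (cyl T Ω))
  slice : ∀ᵐ t ∂(volume.restrict (Ioo 0 T)),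
    MemH10 Ω (fun x => y (t, x)) (fun x => Dy (t, x))

/-- The row divergence `(div a)_j = ∑ i, ∂_{x_i} a_{ij}` of a matrix field. For a Lipschitz field
it exists at almost every point. -/
def divMat {d : ℕ} (A : Space d → Matrix (Fin d) (Fin d) ℝ) (x : Space d) (j : Fin d) : ℝ :=
  ∑ i, fderiv ℝ (fun z => A z i j) x (EuclideanSpace.single i 1)

/-- The bilinear form `⟨L_t v, w⟩` on `H¹₀(Ω)` of the operator
`L_t v = (1/2) tr(a(t,x) D²v) + μ(t,x) · ∇v`,
that is, `∫_Ω (L_t v) w dx` with the second-order term integrated by parts once: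
`∫ a_ij ∂_ij v w = - ∫ a_ij ∂_j v ∂_i w - ∫ (∂_i a_ij) ∂_j v w`.
Only the gradient `Dv` of the first argument enters. -/
def form {d : ℕ} (a : ℝ → Space d → Matrix (Fin d) (Fin d) ℝ) (μ : ℝ → Space d → Space d)
    (Ω : Set (Space d)) (t : ℝ)
    (Dv : Space d → Space d) (w : Space d → ℝ) (Dw : Space d → Space d) : ℝ :=
  ∫ x in Ω,
    (-(1 / 2) * (∑ i, ∑ j, a t x i j * Dv x j * Dw x i)
      - (1 / 2) * (∑ j, divMat (a t) x j * Dv x j) * w x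
      + (∑ j, μ t x j * Dv x j) * w x)

/-- `y` is the weak solution, in `L²(0,T; H¹₀(Ω))`, of
`∂y/∂t + ε L_t y = f` in `(0,T) × Ω`, `y(0,·) = 0` on `Ω`, `y = 0` on `(0,T) × ∂Ω`
(the equation is tested with `φ ∈ C_c^∞(Ω)` and integrated from `0` to `t`). -/
def IsForwardSol {d : ℕ} (ε : ℝ) (a : ℝ → Space d → Matrix (Fin d) (Fin d) ℝ)
    (μ : ℝ → Space d → Space d) (T : ℝ) (Ω : Set (Space d))
    (f y : ℝ × Space d → ℝ) : Prop :=
  ∃ Dy : ℝ × Space d → Space d, MemL2H10 T Ω y Dy ∧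
    ∀ φ : Space d → ℝ, IsTest Ω φ → ∀ᵐ t ∂(volume.restrict (Ioo 0 T)),
      (∫ x in Ω, y (t, x) * φ x)
        + ∫ s in (0 : ℝ)..t,
            ε * form a μ Ω s (fun x => Dy (s, x)) φ (gradient φ)
      = ∫ s in (0 : ℝ)..t, ∫ x in Ω, f (s, x) * φ x

/-- `p` is the weak solution, in `L²(0,T; H¹₀(Ω))`, of
`-∂p/∂t + ε L_t^* p = g` in `(0,T) × Ω`, `p(T,·) = 0` on `Ω`, `p = 0` on `(0,T) × ∂Ω`,
with `⟨L_t^* p, φ⟩ = ⟨L_t φ, p⟩`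
(the equation is tested with `φ ∈ C_c^∞(Ω)` and integrated from `t` to `T`). -/
def IsBackwardSol {d : ℕ} (ε : ℝ) (a : ℝ → Space d → Matrix (Fin d) (Fin d) ℝ)
    (μ : ℝ → Space d → Space d) (T : ℝ) (Ω : Set (Space d))
    (g p : ℝ × Space d → ℝ) : Prop :=
  ∃ Dp : ℝ × Space d → Space d, MemL2H10 T Ω p Dp ∧
    ∀ φ : Space d → ℝ, IsTest Ω φ → ∀ᵐ t ∂(volume.restrict (Ioo 0 T)),
      (∫ x in Ω, p (t, x) * φ x)
        + ∫ s in t..T,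
            ε * form a μ Ω s (gradient φ) (fun x => p (s, x)) (fun x => Dp (s, x))
      = ∫ s in t..T, ∫ x in Ω, g (s, x) * φ x

/-- The function `u χ_S` of `(t,x)`, for `S` a subset of space. -/
def cut {d : ℕ} (S : Set (Space d)) (u : ℝ × Space d → ℝ) : ℝ × Space d → ℝ :=
  {z : ℝ × Space d | z.2 ∈ S}.indicator u

/-- The total control `u₁ χ_{U₁} + u₂ χ_{U₂}`. -/
def control {d : ℕ} (U₁ U₂ : Set (Space d)) (u₁ u₂ : ℝ × Space d → ℝ) : ℝ × Space d → ℝ :=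
  fun z => cut U₁ u₁ z + cut U₂ u₂ z

/-- `y` is the state produced by the leader's control `u₁` and the follower's control `u₂`. -/
def IsState {d : ℕ} (ε : ℝ) (a : ℝ → Space d → Matrix (Fin d) (Fin d) ℝ)
    (μ : ℝ → Space d → Space d) (T : ℝ) (Ω U₁ U₂ : Set (Space d))
    (u₁ u₂ y : ℝ × Space d → ℝ) : Prop :=
  IsForwardSol ε a μ T Ω (control U₁ U₂ u₁ u₂) y

/-- The follower's cost of a total control `u` on `U` with state `y`. -/
def costJ2 {d : ℕ} (β T : ℝ) (Ω U : Set (Space d)) (yref y u : ℝ × Space d → ℝ) : ℝ :=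
  (1 / 2) * (∫ z in cyl T Ω, (y z - yref z) ^ 2) + (β / 2) * (∫ z in cyl T U, u z ^ 2)

/-- `u₂ ∈ L²((0,T) × U₂)` is an optimal response of the follower to the leader's control `u₁`:
it has a state, and its cost is minimal among all controls `v₂ ∈ L²((0,T) × U₂)`. -/
def IsResponse {d : ℕ} (ε : ℝ) (a : ℝ → Space d → Matrix (Fin d) (Fin d) ℝ)
    (μ : ℝ → Space d → Space d) (β T : ℝ) (Ω U U₁ U₂ : Set (Space d))
    (yref u₁ u₂ : ℝ × Space d → ℝ) : Prop :=
  MemLp u₂ 2 (volume.restrict (cyl T U₂)) ∧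
  ∃ y : ℝ × Space d → ℝ, IsState ε a μ T Ω U₁ U₂ u₁ u₂ y ∧
    ∀ v₂ : ℝ × Space d → ℝ, MemLp v₂ 2 (volume.restrict (cyl T U₂)) →
      ∀ y' : ℝ × Space d → ℝ, IsState ε a μ T Ω U₁ U₂ u₁ v₂ y' →
        costJ2 β T Ω U yref y (control U₁ U₂ u₁ u₂)
          ≤ costJ2 β T Ω U yref y' (control U₁ U₂ u₁ v₂)

/-- `(y, p)` solves the coupled system
`∂y/∂t + ε L_t y = u₁ χ_{U₁} - (1/β) p χ_{U₂}`, `-∂p/∂t + ε L_t^* p = y - yref`,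
`y(0,·) = 0`, `p(T,·) = 0`, `y = p = 0` on `(0,T) × ∂Ω`. -/
def IsCoupledSol {d : ℕ} (ε : ℝ) (a : ℝ → Space d → Matrix (Fin d) (Fin d) ℝ)
    (μ : ℝ → Space d → Space d) (β T : ℝ) (Ω U₁ U₂ : Set (Space d))
    (yref u₁ y p : ℝ × Space d → ℝ) : Prop :=
  IsForwardSol ε a μ T Ω (fun z => cut U₁ u₁ z - (1 / β) * cut U₂ p z) y ∧
  IsBackwardSol ε a μ T Ω (fun z => y z - yref z) p

end Follower

end

/-! The cost is a quadratic functional of the state and the total control, so everything rests on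
its first-order term vanishing at the feedback control. For two total controls `f`, `f'` with states
`y`, `y'` this term is ∬(y' - y)(y - yref) + β∬(f' - f)f. The adjoint equation turns the first
integral into ∬(f' - f)p, and (f' - f)(βf + p) = 0 pointwise, because f' - f lives on U₂, where f =
-p/β. What is left (`costJ2_eq_add`) is J' = J + ½‖y' - y‖² + (β/2)‖f' - f‖², which gives minimality
and, as β > 0, uniqueness.

The substance is the duality ∬fp = ∬gy (`integral_source_mul_eq`): an integration by parts in time
for functions known only to lie in L²(0,T; H¹₀). Neither mollification nor a representative
continuous in time is needed. Write ∂y/∂t = F and -∂p/∂t = G, with F, G square-integrable fields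
acting on pairs (φ, ∇φ), and extend everything by zero in time. Testing increments of one function
with the other gives, for δ > 0, ∬(y(t) - y(t-δ)) p(t) = ∫₀^δ K₁ and ∬(p(t) - p(t+δ)) y(t) = ∫₀^δ
K₂, where K₁(r) = ∬⟨F(t-r), (p, Dp)(t)⟩ and K₂(r) = ∬⟨G(t+r), (y, Dy)(t)⟩. The left sides agree
after a shift of time by δ. Translations are continuous in L², hence so are K₁ and K₂, and equality
for all δ > 0 forces K₁(0) = K₂(0) (`integral_inner_jet_eq`). -/

noncomputable section

namespace Follower

/-! ### Pairings of square-integrable fields. -/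

section L2

variable {α : Type*} {mα : MeasurableSpace α} {ν : Measure α}
  {E : Type*} [NormedAddCommGroup E] [InnerProductSpace ℝ E]

theorem integral_inner_eq_inner_toLp {f g : α → E} (hf : MemLp f 2 ν) (hg : MemLp g 2 ν) :
    ∫ x, inner ℝ (f x) (g x) ∂ν = inner ℝ (hf.toLp f) (hg.toLp g) := by
  rw [L2.inner_def]
  refine integral_congr_ae ?_
  filter_upwards [hf.coeFn_toLp, hg.coeFn_toLp] with x h1 h2
  rw [h1, h2]

theorem integrable_inner_of_memLp {f g : α → E} (hf : MemLp f 2 ν) (hg : MemLp g 2 ν) :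
    Integrable (fun x => inner ℝ (f x) (g x)) ν := by
  refine (L2.integrable_inner (𝕜 := ℝ) (hf.toLp f) (hg.toLp g)).congr ?_
  filter_upwards [hf.coeFn_toLp, hg.coeFn_toLp] with x h1 h2
  rw [h1, h2]

theorem tendsto_integral_inner {f g : α → E} {G : ℕ → α → E} (hf : MemLp f 2 ν)
    (hg : MemLp g 2 ν) (hG : ∀ n, MemLp (G n) 2 ν)
    (h : Tendsto (fun n => eLpNorm (G n - g) 2 ν) atTop (nhds 0)) :
    Tendsto (fun n => ∫ x, inner ℝ (f x) (G n x) ∂ν) atTop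
      (nhds (∫ x, inner ℝ (f x) (g x) ∂ν)) := by
  simp_rw [fun n => integral_inner_eq_inner_toLp hf (hG n), integral_inner_eq_inner_toLp hf hg]
  exact tendsto_const_nhds.inner ((Lp.tendsto_Lp_iff_tendsto_eLpNorm'' G hG g hg).2 h)

end L2

/-! ### Translations in time and their continuity in L². -/

section Translation

variable {X : Type*} [MeasurableSpace X] {m : Measure X} [SFinite m]
  {E : Type*} [NormedAddCommGroup E] [InnerProductSpace ℝ E]

theorem measurePreserving_timeShift (r : ℝ) :
    MeasurePreserving (fun z : ℝ × X => (z.1 - r, z.2)) ((volume : Measure ℝ).prod m)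
      ((volume : Measure ℝ).prod m) :=
  (measurePreserving_sub_right volume r).prod (MeasurePreserving.id m)

theorem memLp_timeShift {V : Type*} [NormedAddCommGroup V] {F : ℝ × X → V}
    (hF : MemLp F 2 ((volume : Measure ℝ).prod m)) (r : ℝ) :
    MemLp (fun z : ℝ × X => F (z.1 - r, z.2)) 2 ((volume : Measure ℝ).prod m) :=
  hF.comp_measurePreserving (measurePreserving_timeShift r)

/-- Each fibre map is a translation. This makes the shifted field jointly measurable and
square-integrable in (r, t, x), as Fubini requires. -/
theorem measurePreserving_shear (ν : Measure ℝ) [SFinite ν] (σ : ℝ) :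
    MeasurePreserving (fun q : ℝ × (ℝ × X) => (q.1, (q.2.1 - σ * q.1, q.2.2)))
      (ν.prod ((volume : Measure ℝ).prod m)) (ν.prod ((volume : Measure ℝ).prod m)) := by
  refine (MeasurePreserving.id ν).skew_product
    (g := fun r (z : ℝ × X) => (z.1 - σ * r, z.2)) ?_ ?_
  · fun_prop
  · exact ae_of_all _ fun r => (measurePreserving_timeShift (σ * r)).map_eq

theorem memLp_shear {V : Type*} [NormedAddCommGroup V] {F : ℝ × X → V}
    (hF : MemLp F 2 ((volume : Measure ℝ).prod m))
    (ν : Measure ℝ) [IsFiniteMeasure ν] (σ : ℝ) :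
    MemLp (fun q : ℝ × (ℝ × X) => F (q.2.1 - σ * q.1, q.2.2)) 2
      (ν.prod ((volume : Measure ℝ).prod m)) :=
  (hF.comp_snd ν).comp_measurePreserving (measurePreserving_shear ν σ)

theorem integrable_shear_inner {F P : ℝ × X → E} (hF : MemLp F 2 ((volume : Measure ℝ).prod m))
    (hP : MemLp P 2 ((volume : Measure ℝ).prod m)) (ν : Measure ℝ) [IsFiniteMeasure ν] (σ : ℝ) :
    Integrable (fun q : ℝ × (ℝ × X) => inner ℝ (F (q.2.1 - σ * q.1, q.2.2)) (P q.2))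
      (ν.prod ((volume : Measure ℝ).prod m)) :=
  integrable_inner_of_memLp (memLp_shear hF ν σ) (hP.comp_snd ν)

/-- Fubini in the form needed later: time becomes the outermost variable, so that an identity valid
for almost every `t` can be inserted. The sign `σ` serves the forward and the backward equation at
once. -/
theorem integral_shear_inner {F P : ℝ × X → E} (hF : MemLp F 2 ((volume : Measure ℝ).prod m))
    (hP : MemLp P 2 ((volume : Measure ℝ).prod m)) (ν : Measure ℝ) [IsFiniteMeasure ν] (σ : ℝ) :
    ∫ r, ∫ z : ℝ × X, inner ℝ (F (z.1 - σ * r, z.2)) (P z) ∂((volume : Measure ℝ).prod m) ∂ν =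
      ∫ t : ℝ, ∫ r, ∫ x, inner ℝ (F (t - σ * r, x)) (P (t, x)) ∂m ∂ν := by
  have hG := integrable_shear_inner hF hP ν σ
  have hH : Integrable (fun q : ℝ × ℝ => ∫ x, inner ℝ (F (q.2 - σ * q.1, x)) (P (q.2, x)) ∂m)
      (ν.prod (volume : Measure ℝ)) := by
    have h1 := (measurePreserving_prodAssoc ν (volume : Measure ℝ) m)
    have h2 := h1.integrable_comp_of_integrable hG
    exact h2.integral_prod_left
  refine Eq.trans ?_ (integral_integral_swap hH)
  refine integral_congr_ae ?_
  filter_upwards with r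
  exact integral_prod _
    (integrable_inner_of_memLp (memLp_timeShift hF (σ * r)) hP)

variable [TopologicalSpace X] [BorelSpace X] [T2Space X] [SecondCountableTopology X]
  [IsLocallyFiniteMeasure m] [((volume : Measure ℝ).prod m).InnerRegularCompactLTTop]

theorem continuous_integral_timeShift_inner {F P : ℝ × X → E}
    (hF : MemLp F 2 ((volume : Measure ℝ).prod m))
    (hP : MemLp P 2 ((volume : Measure ℝ).prod m)) (σ : ℝ) :
    Continuous fun r : ℝ =>
      ∫ z : ℝ × X, inner ℝ (F (z.1 - σ * r, z.2)) (P z) ∂((volume : Measure ℝ).prod m) := by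
  let g : ℝ → C(ℝ × X, ℝ × X) := fun r => ⟨fun z => (z.1 - σ * r, z.2), by fun_prop⟩
  have hg : Continuous g := by
    refine ContinuousMap.continuous_of_continuous_uncurry _ ?_
    change Continuous fun q : ℝ × (ℝ × X) => (q.2.1 - σ * q.1, q.2.2)
    fun_prop
  have hgm : ∀ r, MeasurePreserving (g r) ((volume : Measure ℝ).prod m)
      ((volume : Measure ℝ).prod m) := fun r => measurePreserving_timeShift (σ * r)
  have h := (continuous_const (y := hF.toLp F)).compMeasurePreservingLp hg hgm
    (by norm_num : (2 : ℝ≥0∞) ≠ ⊤)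
  have h2 : ∀ r : ℝ, ∫ z : ℝ × X, inner ℝ (F (z.1 - σ * r, z.2)) (P z)
      ∂((volume : Measure ℝ).prod m) =
      inner ℝ (Lp.compMeasurePreserving (g r) (hgm r) (hF.toLp F)) (hP.toLp P) := fun r =>
    integral_inner_eq_inner_toLp (memLp_timeShift hF (σ * r)) hP
  simp_rw [h2]
  exact h.inner continuous_const

end Translation

/-! ### Jets, test functions and countable density in H¹₀. -/

variable {d : ℕ}

/-- The value and the gradient of a function at a point, as a single vector. -/
abbrev Jet (d : ℕ) : Type := WithLp 2 (ℝ × Space d)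

/-- The jet with value `v` and gradient `w`. -/
def jet (v : ℝ) (w : Space d) : Jet d := WithLp.toLp 2 (v, w)

theorem inner_jet (v v' : ℝ) (w w' : Space d) :
    inner ℝ (jet v w) (jet v' w') = v * v' + inner ℝ w w' := by
  simp [jet, WithLp.prod_inner_apply, mul_comm]

theorem memLp_jet {α : Type*} {mα : MeasurableSpace α} {ν : Measure α} {v : α → ℝ}
    {w : α → Space d} (hv : MemLp v 2 ν) (hw : MemLp w 2 ν) :
    MemLp (fun x => jet (v x) (w x)) 2 ν :=
  MemLp.of_fst_of_snd_prodLp ⟨hv, hw⟩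

theorem norm_jet_le (v : ℝ) (w : Space d) : ‖jet v w‖ ≤ ‖(‖v‖ + ‖w‖ : ℝ)‖ := by
  have h : jet v w = jet v 0 + jet 0 w := by
    simp [jet, ← WithLp.toLp_add]
  rw [h, Real.norm_of_nonneg (by positivity)]
  refine (norm_add_le _ _).trans (le_of_eq ?_)
  simp [jet]

theorem eLpNorm_jet_le {α : Type*} {mα : MeasurableSpace α} {ν : Measure α} {v : α → ℝ}
    {w : α → Space d} (hv : AEStronglyMeasurable v ν) (hw : AEStronglyMeasurable w ν) :
    eLpNorm (fun x => jet (v x) (w x)) 2 ν ≤ eLpNorm v 2 ν + eLpNorm w 2 ν := by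
  calc eLpNorm (fun x => jet (v x) (w x)) 2 ν
      ≤ eLpNorm ((fun x => ‖v x‖) + fun x => ‖w x‖) 2 ν :=
        eLpNorm_mono fun x => norm_jet_le (v x) (w x)
    _ ≤ eLpNorm (fun x => ‖v x‖) 2 ν + eLpNorm (fun x => ‖w x‖) 2 ν :=
        eLpNorm_add_le hv.norm hw.norm (by norm_num)
    _ = eLpNorm v 2 ν + eLpNorm w 2 ν := by rw [eLpNorm_norm, eLpNorm_norm]

theorem IsTest.zero (Ω : Set (Space d)) : IsTest Ω (fun _ => (0 : ℝ)) where
  smooth := contDiff_const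
  compact := HasCompactSupport.zero
  support := by
    have : tsupport (fun _ : Space d => (0 : ℝ)) = ∅ := by simp [tsupport]
    simp [this]

theorem IsTest.continuous_gradient {Ω : Set (Space d)} {φ : Space d → ℝ} (h : IsTest Ω φ) :
    Continuous (gradient φ) :=
  (InnerProductSpace.toDual ℝ (Space d)).symm.continuous.comp
    (h.smooth.continuous_fderiv (by simp))

theorem IsTest.hasCompactSupport_gradient {Ω : Set (Space d)} {φ : Space d → ℝ}
    (h : IsTest Ω φ) : HasCompactSupport (gradient φ) :=
  (h.compact.fderiv (𝕜 := ℝ)).comp_left (map_zero (InnerProductSpace.toDual ℝ (Space d)).symm)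

theorem IsTest.memLp {Ω : Set (Space d)} {φ : Space d → ℝ} (h : IsTest Ω φ)
    (m : Measure (Space d)) [IsFiniteMeasureOnCompacts m] : MemLp φ 2 m :=
  h.smooth.continuous.memLp_of_hasCompactSupport h.compact

theorem IsTest.memLp_gradient {Ω : Set (Space d)} {φ : Space d → ℝ} (h : IsTest Ω φ)
    (m : Measure (Space d)) [IsFiniteMeasureOnCompacts m] : MemLp (gradient φ) 2 m :=
  h.continuous_gradient.memLp_of_hasCompactSupport h.hasCompactSupport_gradient

theorem MemH10.memLp_jet {Ω : Set (Space d)} {v : Space d → ℝ} {Dv : Space d → Space d}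
    (h : MemH10 Ω v Dv) : MemLp (fun x => jet (v x) (Dv x)) 2 (volume.restrict Ω) :=
  Follower.memLp_jet h.memLp h.memLp_grad

theorem IsTest.memLp_jet {Ω : Set (Space d)} {φ : Space d → ℝ} (h : IsTest Ω φ)
    (m : Measure (Space d)) [IsFiniteMeasureOnCompacts m] :
    MemLp (fun x => jet (φ x) (gradient φ x)) 2 m :=
  Follower.memLp_jet (h.memLp m) (h.memLp_gradient m)

/-- A sequence of test functions that is dense in `H¹₀(Ω)`. -/
structure IsDenseTestSeq (Ω : Set (Space d)) (φ : ℕ → Space d → ℝ) : Prop where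
  isTest : ∀ n, IsTest Ω (φ n)
  dense : ∀ (v : Space d → ℝ) (Dv : Space d → Space d), MemH10 Ω v Dv → ∃ k : ℕ → ℕ,
    Tendsto (fun n => eLpNorm ((fun x => jet (φ (k n) x) (gradient (φ (k n)) x)) -
      fun x => jet (v x) (Dv x)) 2 (volume.restrict Ω)) atTop (nhds 0)

/-- In the weak formulation the exceptional null set of times depends on the test function. Since L²
is separable, so is the set of jets of test functions; a countable dense family allows a single null
set for all of H¹₀(Ω). -/
theorem exists_isDenseTestSeq (Ω : Set (Space d)) :
    ∃ φ : ℕ → Space d → ℝ, IsDenseTestSeq Ω φ := by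
  let J : {φ : Space d → ℝ // IsTest Ω φ} → Lp (Jet d) 2 (volume.restrict Ω) :=
    fun φ => (φ.2.memLp_jet (volume.restrict Ω)).toLp _
  have : Fact ((2 : ℝ≥0∞) ≠ ⊤) := ⟨by norm_num⟩
  obtain ⟨t, ht, htc, hts⟩ :=
    (TopologicalSpace.IsSeparable.of_separableSpace (range J)).exists_countable_dense_subset
  have htn : t.Nonempty := by
    by_contra hne
    rw [not_nonempty_iff_eq_empty.1 hne, closure_empty] at hts
    exact hts (mem_range_self ⟨_, IsTest.zero Ω⟩)
  obtain ⟨e, rfl⟩ := htc.exists_eq_range htn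
  choose ψ hψ using fun n => ht (mem_range_self n)
  refine ⟨fun n => (ψ n).1, fun n => (ψ n).2, fun v Dv hv => ?_⟩
  have hmem : hv.memLp_jet.toLp _ ∈ closure (range e) := by
    refine closure_minimal hts isClosed_closure ?_
    rw [EMetric.mem_closure_iff]
    intro δ hδ
    obtain ⟨φ, hφ, h1, h2⟩ := hv.approx (δ / 2) (ENNReal.half_pos hδ.ne')
    refine ⟨J ⟨φ, hφ⟩, mem_range_self _, ?_⟩
    rw [Lp.edist_toLp_toLp]
    calc _ ≤ eLpNorm (fun x => v x - φ x) 2 (volume.restrict Ω)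
          + eLpNorm (fun x => Dv x - gradient φ x) 2 (volume.restrict Ω) :=
          eLpNorm_jet_le (hv.memLp.sub (hφ.memLp _)).1 (hv.memLp_grad.sub (hφ.memLp_gradient _)).1
      _ < δ / 2 + δ / 2 := ENNReal.add_lt_add h1 h2
      _ = δ := ENNReal.add_halves δ
  obtain ⟨s, hs, hlim⟩ := mem_closure_iff_seq_limit.1 hmem
  choose k hk using hs
  refine ⟨k, ?_⟩
  rw [← Lp.tendsto_Lp_iff_tendsto_eLpNorm'' _ (fun n => (ψ (k n)).2.memLp_jet _) _ hv.memLp_jet]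
  refine hlim.congr fun n => ?_
  rw [← hk n, ← hψ (k n)]

/-- An identity between continuous linear functionals that holds for test functions
holds on `H¹₀(Ω)`. -/
theorem IsDenseTestSeq.integral_eq {Ω : Set (Space d)} {φ : ℕ → Space d → ℝ}
    (hφ : IsDenseTestSeq Ω φ) {W : Space d → ℝ} (hW : MemLp W 2 (volume.restrict Ω))
    {ν : Measure ℝ} [IsFiniteMeasure ν] {Q : ℝ × Space d → Jet d}
    (hQ : MemLp Q 2 (ν.prod (volume.restrict Ω)))
    (h : ∀ n, ∫ x in Ω, W x * φ n x =
      ∫ r, (∫ x in Ω, inner ℝ (Q (r, x)) (jet (φ n x) (gradient (φ n) x))) ∂ν)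
    {v : Space d → ℝ} {Dv : Space d → Space d} (hv : MemH10 Ω v Dv) :
    ∫ x in Ω, W x * v x = ∫ r, (∫ x in Ω, inner ℝ (Q (r, x)) (jet (v x) (Dv x))) ∂ν := by
  obtain ⟨k, hk⟩ := hφ.dense v Dv hv
  have hT := fun n => (hφ.isTest (k n)).memLp_jet (volume.restrict Ω)
  -- The left side is written as a pairing with the jet (W, 0), so that both sides are L² pairings
  -- against the same jets.
  have h1 := tendsto_integral_inner
    (Follower.memLp_jet hW (MemLp.zero' : MemLp (fun _ => (0 : Space d)) 2 _)) hv.memLp_jet hT hk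
  have h2 := tendsto_integral_inner hQ (hv.memLp_jet.comp_snd ν) (fun n => (hT n).comp_snd ν) (by
    -- Functions independent of `r`: the norm on the product is the spatial norm times a finite
    -- power of the mass of `ν`.
    have h3 : ∀ n, eLpNorm ((fun q : ℝ × Space d => jet (φ (k n) q.2) (gradient (φ (k n)) q.2)) -
        fun q : ℝ × Space d => jet (v q.2) (Dv q.2)) 2 (ν.prod (volume.restrict Ω)) =
        (ν univ) ^ (1 / (2 : ℝ≥0∞)).toReal •
        eLpNorm ((fun x => jet (φ (k n) x) (gradient (φ (k n)) x)) -
          fun x => jet (v x) (Dv x)) 2 (volume.restrict Ω) := fun n => by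
      rw [← eLpNorm_smul_measure_of_ne_top (p := 2) (by norm_num), ← Measure.map_snd_prod,
        eLpNorm_map_measure]
      · rfl
      · rw [Measure.map_snd_prod]
        exact (((hT n).sub hv.memLp_jet).smul_measure (measure_ne_top ν univ)).1
      · fun_prop
    refine Tendsto.congr (fun n => (h3 n).symm) ?_
    have h4 : (ν univ) ^ (1 / (2 : ℝ≥0∞)).toReal ≠ ⊤ :=
      ENNReal.rpow_ne_top_of_nonneg ENNReal.toReal_nonneg (measure_ne_top ν univ)
    simpa using ENNReal.Tendsto.const_mul hk (Or.inr h4))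
  have h5 : ∀ n, ∫ x in Ω, inner ℝ (jet (W x) (0 : Space d))
      (jet (φ (k n) x) (gradient (φ (k n)) x)) =
      ∫ q, inner ℝ (Q q) (jet (φ (k n) q.2) (gradient (φ (k n)) q.2))
        ∂(ν.prod (volume.restrict Ω)) := fun n => by
    rw [integral_prod _ (integrable_inner_of_memLp hQ ((hT n).comp_snd ν))]
    simpa only [inner_jet, inner_zero_left, add_zero] using h (k n)
  have h6 := tendsto_nhds_unique (h1.congr h5) h2
  rw [integral_prod _ (integrable_inner_of_memLp hQ (hv.memLp_jet.comp_snd ν))] at h6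
  simpa only [inner_jet, inner_zero_left, add_zero] using h6

/-! ### Integration by parts in time through increments. -/

theorem ae_memLp_slice {α β : Type*} {mα : MeasurableSpace α} {mβ : MeasurableSpace β}
    {κ : Measure α} {m : Measure β} [SFinite κ] [SFinite m] {w : α × β → ℝ}
    (hw : MemLp w 2 (κ.prod m)) : ∀ᵐ t ∂κ, MemLp (fun x => w (t, x)) 2 m := by
  filter_upwards [hw.1.prodMk_left, hw.integrable_sq.prod_right_ae] with t h1 h2
  exact (memLp_two_iff_integrable_sq h1).2 h2

theorem memLp_reflect_slice {V : Type*} [NormedAddCommGroup V] {m : Measure (Space d)} [SFinite m]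
    {F : ℝ × Space d → V} (hF : MemLp F 2 ((volume : Measure ℝ).prod m)) {σ : ℝ}
    (hσ : σ = 1 ∨ σ = -1) (t : ℝ) (s : Set ℝ) :
    MemLp (fun q : ℝ × Space d => F (t - σ * q.1, q.2)) 2
      (((volume : Measure ℝ).restrict s).prod m) := by
  have h : MeasurePreserving (fun r : ℝ => t - σ * r) volume volume := by
    rcases hσ with rfl | rfl
    · simpa using Measure.measurePreserving_sub_left volume t
    · simpa using measurePreserving_add_left volume t
  have h2 := hF.comp_measurePreserving (h.prod (MeasurePreserving.id m))
  refine h2.mono_measure ?_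
  conv_lhs => rw [← Measure.restrict_univ (μ := m)]
  rw [Measure.prod_restrict]
  exact Measure.restrict_le_self

/-- Testing the time increments of `w` with `p ∈ L²(0,T; H¹₀(Ω))`. -/
theorem integral_increment_mul {Ω : Set (Space d)} {φ : ℕ → Space d → ℝ}
    (hφ : IsDenseTestSeq Ω φ) {T σ δ : ℝ} (hσ : σ = 1 ∨ σ = -1)
    {w p : ℝ × Space d → ℝ} {Dp : ℝ × Space d → Space d} {F : ℝ × Space d → Jet d}
    (hw : MemLp w 2 ((volume : Measure ℝ).prod (volume.restrict Ω)))
    (hF : MemLp F 2 ((volume : Measure ℝ).prod (volume.restrict Ω)))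
    (hp : MemLp p 2 ((volume : Measure ℝ).prod (volume.restrict Ω)))
    (hDp : MemLp Dp 2 ((volume : Measure ℝ).prod (volume.restrict Ω)))
    (hp0 : ∀ t, t ∉ Ioo 0 T → ∀ x, p (t, x) = 0)
    (hDp0 : ∀ t, t ∉ Ioo 0 T → ∀ x, Dp (t, x) = 0)
    (hslice : ∀ᵐ t : ℝ, t ∈ Ioo 0 T → MemH10 Ω (fun x => p (t, x)) (fun x => Dp (t, x)))
    (h : ∀ n, ∀ᵐ t : ℝ, t ∈ Ioo 0 T →
      ∫ x in Ω, (w (t, x) - w (t - σ * δ, x)) * φ n x =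
        ∫ r in Ioc 0 δ, ∫ x in Ω, inner ℝ (F (t - σ * r, x)) (jet (φ n x) (gradient (φ n) x))) :
    ∫ z, (w z - w (z.1 - σ * δ, z.2)) * p z ∂((volume : Measure ℝ).prod (volume.restrict Ω)) =
      ∫ r in Ioc 0 δ, ∫ z, inner ℝ (F (z.1 - σ * r, z.2)) (jet (p z) (Dp z))
        ∂((volume : Measure ℝ).prod (volume.restrict Ω)) := by
  have hW := hw.sub (memLp_timeShift hw (σ * δ))
  have hint : Integrable (fun z => (w z - w (z.1 - σ * δ, z.2)) * p z)
      ((volume : Measure ℝ).prod (volume.restrict Ω)) := hW.integrable_mul hp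
  rw [integral_shear_inner hF (memLp_jet hp hDp), integral_prod _ hint]
  refine integral_congr_ae ?_
  filter_upwards [ae_all_iff.2 h, hslice, ae_memLp_slice hW] with t h1 h2 h3
  by_cases ht : t ∈ Ioo 0 T
  -- For fixed `t`, density carries the increment identity from test functions to the slice of `p`
  -- at the same time.
  · exact hφ.integral_eq h3 (memLp_reflect_slice hF hσ t _) (fun n => h1 n ht) (h2 ht)
  · simp [hp0 t ht, hDp0 t ht, jet]

/-- The primitive of `g` vanishes on [0, ∞), so its right derivative at 0, which is `g 0`, vanishes.
-/
theorem eq_zero_of_forall_integral_Ioc_eq_zero {g : ℝ → ℝ} (hg : Continuous g)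
    (h : ∀ δ, 0 < δ → ∫ r in Ioc 0 δ, g r = 0) : g 0 = 0 := by
  have h1 := (hg.integral_hasStrictDerivAt 0 0).hasDerivAt.hasDerivWithinAt (s := Ici (0 : ℝ))
  have h2 : HasDerivWithinAt (fun u => ∫ r in (0 : ℝ)..u, g r) 0 (Ici (0 : ℝ)) 0 := by
    refine (hasDerivWithinAt_const (0 : ℝ) (Ici (0 : ℝ)) (0 : ℝ)).congr_of_mem
      (fun u hu => ?_) self_mem_Ici
    rcases (mem_Ici.1 hu).eq_or_lt with rfl | hu
    · simp
    · rw [intervalIntegral.integral_of_le hu.le, h u hu]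
  exact (uniqueDiffWithinAt_Ici (0 : ℝ)).eq_deriv _ h1 h2

/-- Integration by parts in time for `y, p ∈ L²(0,T; H¹₀(Ω))` with `∂y/∂t = F`, `-∂p/∂t = G`
in the dual space, `y(0,·) = 0` and `p(T,·) = 0`. The evolution equations are given in terms of
increments of the extensions by zero. -/
theorem integral_inner_jet_eq_of_increments {Ω : Set (Space d)}
    [((volume : Measure ℝ).prod ((volume : Measure (Space d)).restrict Ω)).InnerRegularCompactLTTop]
    {φ : ℕ → Space d → ℝ} (hφ : IsDenseTestSeq Ω φ) {T : ℝ}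
    {y p : ℝ × Space d → ℝ} {Dy Dp : ℝ × Space d → Space d} {F G : ℝ × Space d → Jet d}
    (hy : MemLp y 2 ((volume : Measure ℝ).prod (volume.restrict Ω)))
    (hDy : MemLp Dy 2 ((volume : Measure ℝ).prod (volume.restrict Ω)))
    (hp : MemLp p 2 ((volume : Measure ℝ).prod (volume.restrict Ω)))
    (hDp : MemLp Dp 2 ((volume : Measure ℝ).prod (volume.restrict Ω)))
    (hF : MemLp F 2 ((volume : Measure ℝ).prod (volume.restrict Ω)))
    (hG : MemLp G 2 ((volume : Measure ℝ).prod (volume.restrict Ω)))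
    (hy0 : ∀ t, t ∉ Ioo 0 T → ∀ x, y (t, x) = 0)
    (hDy0 : ∀ t, t ∉ Ioo 0 T → ∀ x, Dy (t, x) = 0)
    (hp0 : ∀ t, t ∉ Ioo 0 T → ∀ x, p (t, x) = 0)
    (hDp0 : ∀ t, t ∉ Ioo 0 T → ∀ x, Dp (t, x) = 0)
    (hyslice : ∀ᵐ t : ℝ, t ∈ Ioo 0 T → MemH10 Ω (fun x => y (t, x)) (fun x => Dy (t, x)))
    (hpslice : ∀ᵐ t : ℝ, t ∈ Ioo 0 T → MemH10 Ω (fun x => p (t, x)) (fun x => Dp (t, x)))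
    (hfwd : ∀ δ, 0 < δ → ∀ n, ∀ᵐ t : ℝ, t ∈ Ioo 0 T →
      ∫ x in Ω, (y (t, x) - y (t - 1 * δ, x)) * φ n x =
        ∫ r in Ioc 0 δ, ∫ x in Ω, inner ℝ (F (t - 1 * r, x)) (jet (φ n x) (gradient (φ n) x)))
    (hbwd : ∀ δ, 0 < δ → ∀ n, ∀ᵐ t : ℝ, t ∈ Ioo 0 T →
      ∫ x in Ω, (p (t, x) - p (t - -1 * δ, x)) * φ n x =
        ∫ r in Ioc 0 δ, ∫ x in Ω, inner ℝ (G (t - -1 * r, x)) (jet (φ n x) (gradient (φ n) x))) :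
    ∫ z, inner ℝ (F z) (jet (p z) (Dp z)) ∂((volume : Measure ℝ).prod (volume.restrict Ω)) =
      ∫ z, inner ℝ (G z) (jet (y z) (Dy z))
        ∂((volume : Measure ℝ).prod (volume.restrict Ω)) := by
  have hK1 := continuous_integral_timeShift_inner hF (memLp_jet hp hDp) 1
  have hK2 := continuous_integral_timeShift_inner hG (memLp_jet hy hDy) (-1)
  have h := eq_zero_of_forall_integral_Ioc_eq_zero (hK1.sub hK2) fun δ hδ => ?_
  · simpa [sub_eq_zero] using h
  · simp only [Pi.sub_apply]
    rw [integral_sub hK1.integrableOn_Ioc hK2.integrableOn_Ioc, sub_eq_zero,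
      ← integral_increment_mul hφ (Or.inl rfl) hy hF hp hDp hp0 hDp0 hpslice (hfwd δ hδ),
      ← integral_increment_mul hφ (Or.inr rfl) hp hG hy hDy hy0 hDy0 hyslice (hbwd δ hδ)]
    simp_rw [sub_mul]
    rw [integral_sub, integral_sub]
    · congr 1
      · simp_rw [mul_comm]
      -- The cross terms y(t-δ)p(t) and p(t+δ)y(t) have the same integral: replace t by t - δ in the
      -- second.
      · have hmp := measurePreserving_timeShift (m := (volume : Measure (Space d)).restrict Ω) δ
        have hint : Integrable (fun z : ℝ × Space d => p (z.1 - -1 * δ, z.2) * y z)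
          ((volume : Measure ℝ).prod (volume.restrict Ω)) :=
          (memLp_timeShift hp (-1 * δ)).integrable_mul hy
        have h3 := integral_map (μ := (volume : Measure ℝ).prod (volume.restrict Ω))
          hmp.measurable.aemeasurable (f := fun z : ℝ × Space d => p (z.1 - -1 * δ, z.2) * y z)
          (by rw [hmp.map_eq]; exact hint.1)
        rw [hmp.map_eq] at h3
        rw [h3]
        simp [mul_comm]
    · exact hp.integrable_mul hy
    · exact (memLp_timeShift hp (-1 * δ)).integrable_mul hy
    · exact hy.integrable_mul hp
    · exact (memLp_timeShift hy (1 * δ)).integrable_mul hp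

/-! ### From the time-integrated equations to increments of the zero extensions. -/

theorem ae_increment_eq_of_forward {k m : ℝ → ℝ} {T : ℝ} (hk : Integrable k)
    (hk0 : ∀ t, t ∉ Ioo 0 T → k t = 0) (hm0 : ∀ t, t ∉ Ioo 0 T → m t = 0)
    (h : ∀ᵐ t : ℝ, t ∈ Ioo 0 T → m t = ∫ s in (0 : ℝ)..t, k s) (δ : ℝ) (hδ : 0 < δ) :
    ∀ᵐ t : ℝ, t ∈ Ioo 0 T → m t - m (t - δ) = ∫ r in Ioc 0 δ, k (t - r) := by
  -- The zero initial value enters here: both sides vanish for t ≤ 0, so the extension creates no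
  -- jump at 0. A jump at `T` is possible, but t - δ < t < T keeps away from it.
  have h1 : ∀ᵐ t : ℝ, t < T → m t = ∫ s in (0 : ℝ)..t, k s := by
    filter_upwards [h] with t ht htT
    rcases lt_or_ge 0 t with h0 | h0
    · exact ht ⟨h0, htT⟩
    · rw [hm0 t fun hc => absurd hc.1 (not_lt.2 h0)]
      refine (intervalIntegral.integral_zero_ae (ae_of_all _ fun s hs => hk0 s fun hc => ?_)).symm
      rw [uIoc_of_ge h0] at hs
      exact absurd hc.1 (not_lt.2 hs.2)
  have h2 := (measurePreserving_sub_right volume δ).quasiMeasurePreserving.ae h1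
  filter_upwards [h1, h2] with t h1 h2 ht
  rw [h1 ht.2, h2 (by linarith [ht.2]), intervalIntegral.integral_interval_sub_left
    hk.intervalIntegrable hk.intervalIntegrable, ← intervalIntegral.integral_of_le hδ.le,
    intervalIntegral.integral_comp_sub_left k t, sub_zero]

/-- The time reversal t ↦ T - t reduces this to the forward case. -/
theorem ae_increment_eq_of_backward {k m : ℝ → ℝ} {T : ℝ} (hk : Integrable k)
    (hk0 : ∀ t, t ∉ Ioo 0 T → k t = 0) (hm0 : ∀ t, t ∉ Ioo 0 T → m t = 0)
    (h : ∀ᵐ t : ℝ, t ∈ Ioo 0 T → m t = ∫ s in t..T, k s) (δ : ℝ) (hδ : 0 < δ) :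
    ∀ᵐ t : ℝ, t ∈ Ioo 0 T → m t - m (t + δ) = ∫ r in Ioc 0 δ, k (t + r) := by
  have hmem : ∀ t, T - t ∈ Ioo 0 T ↔ t ∈ Ioo 0 T := fun t => by
    simp only [mem_Ioo]; constructor <;> rintro ⟨h1, h2⟩ <;> constructor <;> linarith
  have hq := (Measure.measurePreserving_sub_left (volume : Measure ℝ) T).quasiMeasurePreserving
  have h1 := ae_increment_eq_of_forward (k := fun s => k (T - s)) (m := fun s => m (T - s)) (T := T)
    (hk.comp_sub_left T) (fun t ht => hk0 _ (by rwa [hmem])) (fun t ht => hm0 _ (by rwa [hmem]))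
    (by
      filter_upwards [hq.ae h] with t ht ht'
      rw [ht ((hmem t).2 ht'), intervalIntegral.integral_comp_sub_left k T, sub_zero]) δ hδ
  filter_upwards [hq.ae h1] with t ht ht'
  have := ht ((hmem t).2 ht')
  simpa [sub_sub, sub_sub_sub_cancel_left, sub_add, add_comm] using this

/-- The extension by zero of a function on the cylinder to all times. -/
def zeroExt {V : Type*} [Zero V] (T : ℝ) (f : ℝ × Space d → V) : ℝ × Space d → V :=
  {z : ℝ × Space d | z.1 ∈ Ioo 0 T}.indicator f

theorem zeroExt_of_mem {V : Type*} [Zero V] {T t : ℝ} (ht : t ∈ Ioo 0 T) (f : ℝ × Space d → V)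
    (x : Space d) : zeroExt T f (t, x) = f (t, x) :=
  indicator_of_mem (s := {z : ℝ × Space d | z.1 ∈ Ioo 0 T}) ht f

theorem zeroExt_of_notMem {V : Type*} [Zero V] {T t : ℝ} (ht : t ∉ Ioo 0 T)
    (f : ℝ × Space d → V) (x : Space d) : zeroExt T f (t, x) = 0 :=
  indicator_of_notMem (s := {z : ℝ × Space d | z.1 ∈ Ioo 0 T}) ht f

theorem restrict_cyl (T : ℝ) (Ω : Set (Space d)) :
    (volume : Measure (ℝ × Space d)).restrict (cyl T Ω) =
      ((volume : Measure ℝ).restrict (Ioo 0 T)).prod (volume.restrict Ω) :=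
  (Measure.prod_restrict _ _).symm

theorem restrict_timeStrip (T : ℝ) (Ω : Set (Space d)) :
    ((volume : Measure ℝ).prod ((volume : Measure (Space d)).restrict Ω)).restrict
      {z : ℝ × Space d | z.1 ∈ Ioo 0 T} = volume.restrict (cyl T Ω) := by
  have h : {z : ℝ × Space d | z.1 ∈ Ioo 0 T} = Ioo 0 T ×ˢ univ := by ext; simp
  rw [h, ← Measure.prod_restrict, Measure.restrict_univ, restrict_cyl]

theorem measurableSet_timeStrip (T : ℝ) :
    MeasurableSet {z : ℝ × Space d | z.1 ∈ Ioo 0 T} :=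
  measurable_fst measurableSet_Ioo

theorem memLp_zeroExt {V : Type*} [NormedAddCommGroup V] {T : ℝ} {Ω : Set (Space d)}
    {f : ℝ × Space d → V} (hf : MemLp f 2 (volume.restrict (cyl T Ω))) :
    MemLp (zeroExt T f) 2 ((volume : Measure ℝ).prod (volume.restrict Ω)) := by
  rw [zeroExt, memLp_indicator_iff_restrict (measurableSet_timeStrip T), restrict_timeStrip]
  exact hf

theorem integrable_inner_test {T : ℝ} {Ω : Set (Space d)} {F : ℝ × Space d → Jet d}
    (hF : MemLp F 2 (volume.restrict (cyl T Ω))) {φ : Space d → ℝ} (hφ : IsTest Ω φ) :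
    Integrable (fun z : ℝ × Space d => inner ℝ (F z) (jet (φ z.2) (gradient φ z.2)))
      (((volume : Measure ℝ).restrict (Ioo 0 T)).prod (volume.restrict Ω)) := by
  rw [restrict_cyl] at hF
  exact integrable_inner_of_memLp hF ((hφ.memLp_jet _).comp_snd _)

theorem integrable_integral_inner_zeroExt {T : ℝ} {Ω : Set (Space d)} {F : ℝ × Space d → Jet d}
    (hF : MemLp F 2 (volume.restrict (cyl T Ω))) {φ : Space d → ℝ} (hφ : IsTest Ω φ) :
    Integrable fun s : ℝ =>
      ∫ x in Ω, inner ℝ (zeroExt T F (s, x)) (jet (φ x) (gradient φ x)) := by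
  have h := (integrable_inner_test hF hφ).integral_prod_left
  have h2 := (integrable_indicator_iff measurableSet_Ioo).2 h
  refine h2.congr (ae_of_all _ fun s => ?_)
  by_cases hs : s ∈ Ioo 0 T
  · simp only [indicator_of_mem hs, zeroExt_of_mem hs]
  · simp only [indicator_of_notMem hs, zeroExt_of_notMem hs, inner_zero_left, integral_zero]

theorem ae_integral_increment_mul {T : ℝ} {Ω : Set (Space d)} {y : ℝ × Space d → ℝ}
    (hy : MemLp y 2 (volume.restrict (cyl T Ω))) {φ : Space d → ℝ} (hφ : IsTest Ω φ) (c : ℝ) :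
    ∀ᵐ t : ℝ, ∫ x in Ω, (zeroExt T y (t, x) - zeroExt T y (t - c, x)) * φ x =
      (∫ x in Ω, zeroExt T y (t, x) * φ x) - ∫ x in Ω, zeroExt T y (t - c, x) * φ x := by
  have h := ae_memLp_slice (memLp_zeroExt hy)
  filter_upwards [h, (measurePreserving_sub_right volume c).quasiMeasurePreserving.ae h]
    with t h1 h2
  simp_rw [sub_mul]
  exact integral_sub (h1.integrable_mul (hφ.memLp _)) (h2.integrable_mul (hφ.memLp _))

theorem integral_zeroExt_mul_of_notMem {T t : ℝ} (ht : t ∉ Ioo 0 T) (Ω : Set (Space d))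
    (y : ℝ × Space d → ℝ) (φ : Space d → ℝ) : ∫ x in Ω, zeroExt T y (t, x) * φ x = 0 := by
  simp [zeroExt_of_notMem ht]

theorem integral_inner_zeroExt_of_notMem {T t : ℝ} (ht : t ∉ Ioo 0 T) (Ω : Set (Space d))
    (F : ℝ × Space d → Jet d) (φ : Space d → ℝ) :
    ∫ x in Ω, inner ℝ (zeroExt T F (t, x)) (jet (φ x) (gradient φ x)) = 0 := by
  simp [zeroExt_of_notMem ht]

theorem ae_increment_zeroExt_of_forward {T : ℝ} {Ω : Set (Space d)} {y : ℝ × Space d → ℝ}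
    {F : ℝ × Space d → Jet d} (hy : MemLp y 2 (volume.restrict (cyl T Ω)))
    (hF : MemLp F 2 (volume.restrict (cyl T Ω))) {φ : Space d → ℝ} (hφ : IsTest Ω φ)
    (h : ∀ᵐ t : ℝ, t ∈ Ioo 0 T → ∫ x in Ω, y (t, x) * φ x =
      ∫ s in (0 : ℝ)..t, ∫ x in Ω, inner ℝ (F (s, x)) (jet (φ x) (gradient φ x)))
    (δ : ℝ) (hδ : 0 < δ) :
    ∀ᵐ t : ℝ, t ∈ Ioo 0 T →
      ∫ x in Ω, (zeroExt T y (t, x) - zeroExt T y (t - 1 * δ, x)) * φ x =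
        ∫ r in Ioc 0 δ, ∫ x in Ω,
          inner ℝ (zeroExt T F (t - 1 * r, x)) (jet (φ x) (gradient φ x)) := by
  have h1 := ae_increment_eq_of_forward
    (m := fun t => ∫ x in Ω, zeroExt T y (t, x) * φ x)
    (integrable_integral_inner_zeroExt hF hφ)
    (fun t ht => integral_inner_zeroExt_of_notMem ht Ω F φ)
    (fun t ht => integral_zeroExt_mul_of_notMem ht Ω y φ) (by
      filter_upwards [h] with t ht htT
      simp only [zeroExt_of_mem htT]
      rw [ht htT]
      refine intervalIntegral.integral_congr_ae (ae_of_all _ fun s hs => ?_)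
      rw [uIoc_of_le htT.1.le] at hs
      simp only [zeroExt_of_mem (show s ∈ Ioo 0 T from ⟨hs.1, hs.2.trans_lt htT.2⟩)]) δ hδ
  filter_upwards [h1, ae_integral_increment_mul hy hφ δ] with t h1 h2 ht
  simp only [one_mul]
  rw [h2, h1 ht]

theorem ae_increment_zeroExt_of_backward {T : ℝ} {Ω : Set (Space d)} {y : ℝ × Space d → ℝ}
    {F : ℝ × Space d → Jet d} (hy : MemLp y 2 (volume.restrict (cyl T Ω)))
    (hF : MemLp F 2 (volume.restrict (cyl T Ω))) {φ : Space d → ℝ} (hφ : IsTest Ω φ)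
    (h : ∀ᵐ t : ℝ, t ∈ Ioo 0 T → ∫ x in Ω, y (t, x) * φ x =
      ∫ s in t..T, ∫ x in Ω, inner ℝ (F (s, x)) (jet (φ x) (gradient φ x)))
    (δ : ℝ) (hδ : 0 < δ) :
    ∀ᵐ t : ℝ, t ∈ Ioo 0 T →
      ∫ x in Ω, (zeroExt T y (t, x) - zeroExt T y (t - -1 * δ, x)) * φ x =
        ∫ r in Ioc 0 δ, ∫ x in Ω,
          inner ℝ (zeroExt T F (t - -1 * r, x)) (jet (φ x) (gradient φ x)) := by
  have h1 := ae_increment_eq_of_backward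
    (m := fun t => ∫ x in Ω, zeroExt T y (t, x) * φ x)
    (integrable_integral_inner_zeroExt hF hφ)
    (fun t ht => integral_inner_zeroExt_of_notMem ht Ω F φ)
    (fun t ht => integral_zeroExt_mul_of_notMem ht Ω y φ) (by
      filter_upwards [h] with t ht htT
      simp only [zeroExt_of_mem htT]
      rw [ht htT]
      -- The endpoint s = T belongs to (t, T] but not to (0, T), so here the integrands are compared
      -- only off a null set.
      refine intervalIntegral.integral_congr_ae ?_
      filter_upwards [(measure_eq_zero_iff_ae_notMem (μ := (volume : Measure ℝ))).1
        (measure_singleton T)] with s hsT hs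
      rw [uIoc_of_le htT.2.le] at hs
      simp only [zeroExt_of_mem
        (show s ∈ Ioo 0 T from ⟨htT.1.trans hs.1, lt_of_le_of_ne hs.2 hsT⟩)]) δ hδ
  filter_upwards [h1, ae_integral_increment_mul hy hφ (-δ)] with t h1 h2 ht
  simp only [neg_mul, one_mul]
  rw [h2]
  simp only [sub_neg_eq_add]
  rw [h1 ht]

/-- Integration by parts in time for `y, p ∈ L²(0,T; H¹₀(Ω))` with `∂y/∂t = F`, `-∂p/∂t = G`
in the dual space, `y(0,·) = 0` and `p(T,·) = 0`. -/
theorem integral_inner_jet_eq {T : ℝ} {Ω : Set (Space d)}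
    {y p : ℝ × Space d → ℝ} {Dy Dp : ℝ × Space d → Space d} {F G : ℝ × Space d → Jet d}
    (hy : MemL2H10 T Ω y Dy) (hp : MemL2H10 T Ω p Dp)
    (hF : MemLp F 2 (volume.restrict (cyl T Ω))) (hG : MemLp G 2 (volume.restrict (cyl T Ω)))
    (hfwd : ∀ φ, IsTest Ω φ → ∀ᵐ t : ℝ, t ∈ Ioo 0 T → ∫ x in Ω, y (t, x) * φ x =
      ∫ s in (0 : ℝ)..t, ∫ x in Ω, inner ℝ (F (s, x)) (jet (φ x) (gradient φ x)))
    (hbwd : ∀ φ, IsTest Ω φ → ∀ᵐ t : ℝ, t ∈ Ioo 0 T → ∫ x in Ω, p (t, x) * φ x =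
      ∫ s in t..T, ∫ x in Ω, inner ℝ (G (s, x)) (jet (φ x) (gradient φ x))) :
    ∫ z in cyl T Ω, inner ℝ (F z) (jet (p z) (Dp z)) =
      ∫ z in cyl T Ω, inner ℝ (G z) (jet (y z) (Dy z)) := by
  obtain ⟨φ, hφ⟩ := exists_isDenseTestSeq Ω
  have hslice : ∀ {v : ℝ × Space d → ℝ} {Dv : ℝ × Space d → Space d}, MemL2H10 T Ω v Dv →
      ∀ᵐ t : ℝ, t ∈ Ioo 0 T →
        MemH10 Ω (fun x => zeroExt T v (t, x)) (fun x => zeroExt T Dv (t, x)) := fun hv => by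
    filter_upwards [(ae_restrict_iff' measurableSet_Ioo).1 hv.slice] with t h1 ht
    simpa only [zeroExt_of_mem ht] using h1 ht
  have key := integral_inner_jet_eq_of_increments hφ (T := T)
    (memLp_zeroExt hy.memLp) (memLp_zeroExt hy.memLp_grad)
    (memLp_zeroExt hp.memLp) (memLp_zeroExt hp.memLp_grad)
    (memLp_zeroExt hF) (memLp_zeroExt hG)
    (fun t ht => zeroExt_of_notMem ht y) (fun t ht => zeroExt_of_notMem ht Dy)
    (fun t ht => zeroExt_of_notMem ht p) (fun t ht => zeroExt_of_notMem ht Dp)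
    (hslice hy) (hslice hp)
    (fun δ hδ n => ae_increment_zeroExt_of_forward hy.memLp hF (hφ.isTest n)
      (hfwd _ (hφ.isTest n)) δ hδ)
    (fun δ hδ n => ae_increment_zeroExt_of_backward hp.memLp hG (hφ.isTest n)
      (hbwd _ (hφ.isTest n)) δ hδ)
  have hext : ∀ (H : ℝ × Space d → Jet d) (v : ℝ × Space d → ℝ) (Dv : ℝ × Space d → Space d),
      ∫ z, inner ℝ (zeroExt T H z) (jet (zeroExt T v z) (zeroExt T Dv z))
        ∂((volume : Measure ℝ).prod (volume.restrict Ω)) =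
      ∫ z in cyl T Ω, inner ℝ (H z) (jet (v z) (Dv z)) := fun H v Dv => by
    rw [← restrict_timeStrip, ← integral_indicator (measurableSet_timeStrip T)]
    refine integral_congr_ae (ae_of_all _ fun z => ?_)
    by_cases hz : z ∈ {z : ℝ × Space d | z.1 ∈ Ioo 0 T}
    · simp only [zeroExt, indicator_of_mem hz]
    · simp only [zeroExt, indicator_of_notMem hz, inner_zero_left]
  rwa [hext, hext] at key

/-! ### Bounded coefficients and the equations as fields of jets. -/

theorem isBounded_cyl {T : ℝ} {Ω : Set (Space d)} (hΩ : Bornology.IsBounded Ω) :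
    Bornology.IsBounded (cyl T Ω) :=
  (Metric.isBounded_Ioo 0 T).prod hΩ

theorem measurableSet_cyl {T : ℝ} {Ω : Set (Space d)} (hΩ : MeasurableSet Ω) :
    MeasurableSet (cyl T Ω) :=
  measurableSet_Ioo.prod hΩ

theorem cyl_subset (T : ℝ) (Ω : Set (Space d)) : cyl T Ω ⊆ Ici 0 ×ˢ univ :=
  fun _ hz => ⟨hz.1.1.le, mem_univ _⟩

theorem memLp_top_of_lipschitzOnWith {V : Type*} [NormedAddCommGroup V]
    [SecondCountableTopology V] {T : ℝ} {Ω : Set (Space d)} (hΩ : MeasurableSet Ω)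
    (hΩb : Bornology.IsBounded Ω) {f : ℝ × Space d → V} {K : NNReal}
    (hf : LipschitzOnWith K f (Ici 0 ×ˢ univ)) : MemLp f ⊤ (volume.restrict (cyl T Ω)) := by
  borelize V
  have hf' := hf.mono (cyl_subset T Ω)
  have hm := hf'.continuousOn.aestronglyMeasurable (μ := volume) (measurableSet_cyl hΩ)
  rcases (cyl T Ω).eq_empty_or_nonempty with h0 | ⟨z₀, hz₀⟩
  · simp [h0]
  obtain ⟨R, hR⟩ := (Metric.isBounded_iff.1 (isBounded_cyl (T := T) hΩb))
  refine memLp_top_of_bound hm (‖f z₀‖ + K * R) ?_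
  filter_upwards [ae_restrict_mem (measurableSet_cyl hΩ)] with z hz
  have h1 := hf'.dist_le_mul z hz z₀ hz₀
  have h2 : (K : ℝ) * dist z z₀ ≤ K * R := mul_le_mul_of_nonneg_left (hR hz hz₀) K.2
  have h3 := norm_le_norm_add_norm_sub' (f z) (f z₀)
  rw [dist_eq_norm] at h1
  linarith

/-- The Lipschitz constant bounds `fderiv` at every point, since its default value is 0 where the
derivative fails to exist. Joint measurability follows from joint continuity of the function. -/
theorem memLp_top_fderiv_apply {T : ℝ} {Ω : Set (Space d)} (hΩ : MeasurableSet Ω)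
    {f : ℝ → Space d → ℝ} {K : NNReal}
    (hf : LipschitzOnWith K (fun z : ℝ × Space d => f z.1 z.2) (Ici 0 ×ˢ univ)) (e : Space d) :
    MemLp (fun z : ℝ × Space d => fderiv ℝ (f z.1) z.2 e) ⊤ (volume.restrict (cyl T Ω)) := by
  -- The hypothesis covers only t ≥ 0; freezing `f` at negative times makes it continuous everywhere
  -- and changes nothing on the cylinder.
  have hcont : Continuous (Function.uncurry fun t x => f (max t 0) x) := by
    refine hf.continuousOn.comp_continuous (f := fun z : ℝ × Space d => (max z.1 0, z.2))
      (by fun_prop) fun z => ⟨mem_Ici.2 (le_max_right _ _), mem_univ _⟩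
  have hmeas := measurable_fderiv_apply_const_with_param ℝ hcont e
  have hae : (fun z : ℝ × Space d => fderiv ℝ (f (max z.1 0)) z.2 e)
      =ᵐ[volume.restrict (cyl T Ω)] fun z => fderiv ℝ (f z.1) z.2 e := by
    filter_upwards [ae_restrict_mem (measurableSet_cyl hΩ)] with z hz
    rw [max_eq_left hz.1.1.le]
  refine memLp_top_of_bound (hmeas.aestronglyMeasurable.congr hae) (K * ‖e‖) ?_
  filter_upwards [ae_restrict_mem (measurableSet_cyl hΩ)] with z hz
  have hlip : LipschitzWith K (f z.1) := LipschitzWith.of_dist_le_mul fun x x' => by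
    have := hf.dist_le_mul (z.1, x) ⟨hz.1.1.le, mem_univ _⟩ (z.1, x') ⟨hz.1.1.le, mem_univ _⟩
    simpa [Prod.dist_eq] using this
  exact (ContinuousLinearMap.le_opNorm _ e).trans
    (mul_le_mul_of_nonneg_right (norm_fderiv_le_of_lipschitz ℝ hlip) (norm_nonneg e))

/-- The coefficients of the bilinear form are essentially bounded on the cylinder. -/
structure BoundedCoeff (a : ℝ → Space d → Matrix (Fin d) (Fin d) ℝ)
    (μ : ℝ → Space d → Space d) (T : ℝ) (Ω : Set (Space d)) : Prop where
  mat : ∀ i j, MemLp (fun z : ℝ × Space d => a z.1 z.2 i j) ⊤ (volume.restrict (cyl T Ω))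
  drift : ∀ j, MemLp (fun z : ℝ × Space d => μ z.1 z.2 j) ⊤ (volume.restrict (cyl T Ω))
  div : ∀ j, MemLp (fun z : ℝ × Space d => divMat (a z.1) z.2 j) ⊤ (volume.restrict (cyl T Ω))

theorem boundedCoeff_of_lipschitz {T : ℝ} {Ω : Set (Space d)} (hΩ : MeasurableSet Ω)
    (hΩb : Bornology.IsBounded Ω) {a : ℝ → Space d → Matrix (Fin d) (Fin d) ℝ}
    {μ : ℝ → Space d → Space d}
    (ha : ∀ i j, ∃ K, LipschitzOnWith K (fun z : ℝ × Space d => a z.1 z.2 i j) (Ici 0 ×ˢ univ))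
    (hμ : ∃ K, LipschitzOnWith K (fun z : ℝ × Space d => μ z.1 z.2) (Ici 0 ×ˢ univ)) :
    BoundedCoeff a μ T Ω where
  mat i j := memLp_top_of_lipschitzOnWith hΩ hΩb (ha i j).choose_spec
  drift j := (memLp_top_of_lipschitzOnWith hΩ hΩb hμ.choose_spec).eval_piLp j
  div j := memLp_finsetSum _ fun i _ =>
    memLp_top_fderiv_apply (f := fun t x => a t x i j) hΩ (ha i j).choose_spec _

/-- The functional `φ ↦ ∫ f φ - ε ⟨L y, φ⟩` as a field of jets. -/
def forwardJet (ε : ℝ) (a : ℝ → Space d → Matrix (Fin d) (Fin d) ℝ) (μ : ℝ → Space d → Space d)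
    (f : ℝ × Space d → ℝ) (Dy : ℝ × Space d → Space d) (z : ℝ × Space d) : Jet d :=
  jet (f z - ε * (-(1 / 2) * (∑ j, divMat (a z.1) z.2 j * Dy z j) + ∑ j, μ z.1 z.2 j * Dy z j))
    (WithLp.toLp 2 fun i => ε * (1 / 2) * ∑ j, a z.1 z.2 i j * Dy z j)

/-- The functional `φ ↦ ∫ g φ - ε ⟨L φ, p⟩` as a field of jets. -/
def backwardJet (ε : ℝ) (a : ℝ → Space d → Matrix (Fin d) (Fin d) ℝ) (μ : ℝ → Space d → Space d)
    (g p : ℝ × Space d → ℝ) (Dp : ℝ × Space d → Space d) (z : ℝ × Space d) : Jet d :=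
  jet (g z) (WithLp.toLp 2 fun j => ε * ((1 / 2) * (∑ i, a z.1 z.2 i j * Dp z i)
    + (1 / 2) * (divMat (a z.1) z.2 j * p z) - μ z.1 z.2 j * p z))

/-- The integrand of the bilinear form. -/
def formIntegrand (a : ℝ → Space d → Matrix (Fin d) (Fin d) ℝ) (μ : ℝ → Space d → Space d)
    (z : ℝ × Space d) (Dv : Space d) (w : ℝ) (Dw : Space d) : ℝ :=
  -(1 / 2) * (∑ i, ∑ j, a z.1 z.2 i j * Dv j * Dw i)
    - (1 / 2) * (∑ j, divMat (a z.1) z.2 j * Dv j) * w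
    + (∑ j, μ z.1 z.2 j * Dv j) * w

theorem real_inner_eq_mul (x y : ℝ) : inner ℝ x y = x * y := by
  simp [mul_comm]

theorem inner_forwardJet (ε : ℝ) (a : ℝ → Space d → Matrix (Fin d) (Fin d) ℝ)
    (μ : ℝ → Space d → Space d) (f : ℝ × Space d → ℝ) (Dy : ℝ × Space d → Space d)
    (z : ℝ × Space d) (w : ℝ) (Dw : Space d) :
    inner ℝ (forwardJet ε a μ f Dy z) (jet w Dw) =
      f z * w - ε * formIntegrand a μ z (Dy z) w Dw := by
  rw [forwardJet, inner_jet, formIntegrand, PiLp.inner_apply]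
  have h : ∑ i, inner ℝ (ε * (1 / 2) * ∑ j, a z.1 z.2 i j * Dy z j) (Dw i) =
      ε * (1 / 2) * ∑ i, ∑ j, a z.1 z.2 i j * Dy z j * Dw i := by
    rw [Finset.mul_sum]
    refine Finset.sum_congr rfl fun i _ => ?_
    rw [← Finset.sum_mul]
    rw [real_inner_eq_mul]
    ring
  simp only [h]
  ring

theorem inner_backwardJet (ε : ℝ) (a : ℝ → Space d → Matrix (Fin d) (Fin d) ℝ)
    (μ : ℝ → Space d → Space d) (g p : ℝ × Space d → ℝ) (Dp : ℝ × Space d → Space d)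
    (z : ℝ × Space d) (v : ℝ) (Dv : Space d) :
    inner ℝ (backwardJet ε a μ g p Dp z) (jet v Dv) =
      g z * v - ε * formIntegrand a μ z Dv (p z) (Dp z) := by
  rw [backwardJet, inner_jet, formIntegrand, PiLp.inner_apply, Finset.sum_comm]
  have h : ∑ j, inner ℝ (ε * ((1 / 2) * (∑ i, a z.1 z.2 i j * Dp z i)
      + (1 / 2) * (divMat (a z.1) z.2 j * p z) - μ z.1 z.2 j * p z)) (Dv j) =
      ε * ((1 / 2) * (∑ j, ∑ i, a z.1 z.2 i j * Dv j * Dp z i)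
        + (1 / 2) * (∑ j, divMat (a z.1) z.2 j * Dv j) * p z
        - (∑ j, μ z.1 z.2 j * Dv j) * p z) := by
    simp only [mul_assoc, Finset.mul_sum, Finset.sum_mul, ← Finset.sum_add_distrib,
      ← Finset.sum_sub_distrib]
    refine Finset.sum_congr rfl fun j _ => ?_
    rw [real_inner_eq_mul]
    simp only [mul_add, mul_sub, add_mul, sub_mul, Finset.mul_sum, Finset.sum_mul]
    congr 1
    · congr 1
      · exact Finset.sum_congr rfl fun i _ => by ring
      · ring
    · ring
  simp only [h]
  ring

/-! ### Duality of the forward and the backward equation. -/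

section Duality

variable {a : ℝ → Space d → Matrix (Fin d) (Fin d) ℝ} {μ : ℝ → Space d → Space d}
  {T : ℝ} {Ω : Set (Space d)}

theorem BoundedCoeff.memLp_forwardJet (hc : BoundedCoeff a μ T Ω) (ε : ℝ) {f : ℝ × Space d → ℝ}
    {Dy : ℝ × Space d → Space d} (hf : MemLp f 2 (volume.restrict (cyl T Ω)))
    (hDy : MemLp Dy 2 (volume.restrict (cyl T Ω))) :
    MemLp (forwardJet ε a μ f Dy) 2 (volume.restrict (cyl T Ω)) := by
  have h1 : MemLp (fun z => ∑ j, divMat (a z.1) z.2 j * Dy z j) 2 (volume.restrict (cyl T Ω)) :=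
    memLp_finsetSum _ fun j _ => (hDy.eval_piLp j).mul (hc.div j)
  have h2 : MemLp (fun z => ∑ j, μ z.1 z.2 j * Dy z j) 2 (volume.restrict (cyl T Ω)) :=
    memLp_finsetSum _ fun j _ => (hDy.eval_piLp j).mul (hc.drift j)
  have h3 : ∀ i, MemLp (fun z => ∑ j, a z.1 z.2 i j * Dy z j) 2 (volume.restrict (cyl T Ω)) :=
    fun i => memLp_finsetSum _ fun j _ => (hDy.eval_piLp j).mul (hc.mat i j)
  exact memLp_jet (hf.sub (((h1.const_mul (-(1 / 2))).add h2).const_mul ε))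
    (MemLp.of_eval_piLp fun i => (h3 i).const_mul (ε * (1 / 2)))

theorem BoundedCoeff.memLp_backwardJet (hc : BoundedCoeff a μ T Ω) (ε : ℝ)
    {g p : ℝ × Space d → ℝ} {Dp : ℝ × Space d → Space d}
    (hg : MemLp g 2 (volume.restrict (cyl T Ω))) (hp : MemLp p 2 (volume.restrict (cyl T Ω)))
    (hDp : MemLp Dp 2 (volume.restrict (cyl T Ω))) :
    MemLp (backwardJet ε a μ g p Dp) 2 (volume.restrict (cyl T Ω)) := by
  have h1 : ∀ j, MemLp (fun z => divMat (a z.1) z.2 j * p z) 2 (volume.restrict (cyl T Ω)) :=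
    fun j => hp.mul (hc.div j)
  have h2 : ∀ j, MemLp (fun z => μ z.1 z.2 j * p z) 2 (volume.restrict (cyl T Ω)) :=
    fun j => hp.mul (hc.drift j)
  have h3 : ∀ j, MemLp (fun z => ∑ i, a z.1 z.2 i j * Dp z i) 2 (volume.restrict (cyl T Ω)) :=
    fun j => memLp_finsetSum _ fun i _ => (hDp.eval_piLp i).mul (hc.mat i j)
  exact memLp_jet hg (MemLp.of_eval_piLp fun j =>
    ((((h3 j).const_mul (1 / 2)).add ((h1 j).const_mul (1 / 2))).sub (h2 j)).const_mul ε)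

theorem integrable_mul_test {f : ℝ × Space d → ℝ} (hf : MemLp f 2 (volume.restrict (cyl T Ω)))
    {φ : Space d → ℝ} (hφ : IsTest Ω φ) :
    Integrable (fun z : ℝ × Space d => f z * φ z.2)
      (((volume : Measure ℝ).restrict (Ioo 0 T)).prod (volume.restrict Ω)) := by
  rw [restrict_cyl] at hf
  exact hf.integrable_mul ((hφ.memLp (volume.restrict Ω)).comp_snd _)

/-- Moving an elliptic term to the right-hand side of a weak equation on a time interval. -/
theorem integral_mul_test_sub {f : ℝ × Space d → ℝ} {B : ℝ × Space d → ℝ} {ε : ℝ}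
    {F : ℝ × Space d → Jet d} (hf : MemLp f 2 (volume.restrict (cyl T Ω)))
    (hF : MemLp F 2 (volume.restrict (cyl T Ω))) {φ : Space d → ℝ} (hφ : IsTest Ω φ)
    (hB : ∀ z, inner ℝ (F z) (jet (φ z.2) (gradient φ z.2)) = f z * φ z.2 - ε * B z)
    {s t : ℝ} (hst : s ≤ t) (hs : 0 ≤ s) (ht : t ≤ T) :
    (∫ r in s..t, ∫ x in Ω, f (r, x) * φ x) - ∫ r in s..t, ε * ∫ x in Ω, B (r, x) =
      ∫ r in s..t, ∫ x in Ω, inner ℝ (F (r, x)) (jet (φ x) (gradient φ x)) := by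
  have h1 := integrable_mul_test hf hφ
  -- By `hB` the elliptic term is a difference of two integrable functions.
  have h2 : Integrable (fun z => ε * B z)
      (((volume : Measure ℝ).restrict (Ioo 0 T)).prod (volume.restrict Ω)) :=
    (h1.sub (integrable_inner_test hF hφ)).congr (ae_of_all _ fun z => by
      simp only [Pi.sub_apply, hB]; ring)
  have hle : (volume : Measure ℝ).restrict (Ioc s t) ≤ volume.restrict (Ioo 0 T) := by
    rw [← restrict_Ioo_eq_restrict_Ioc]
    exact Measure.restrict_mono (Ioo_subset_Ioo hs ht) le_rfl
  simp_rw [intervalIntegral.integral_of_le hst, ← integral_const_mul]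
  rw [← integral_sub (h1.integral_prod_left.mono_measure hle)
    (h2.integral_prod_left.mono_measure hle)]
  refine integral_congr_ae ?_
  filter_upwards [ae_mono hle h1.prod_right_ae, ae_mono hle h2.prod_right_ae] with r h3 h4
  rw [← integral_sub h3 h4]
  exact integral_congr_ae (ae_of_all _ fun x => (hB (r, x)).symm)

/-- The duality between the forward and the backward equation. -/
theorem integral_source_mul_eq (hc : BoundedCoeff a μ T Ω) {ε : ℝ} {f g y p : ℝ × Space d → ℝ}
    (hf : MemLp f 2 (volume.restrict (cyl T Ω))) (hg : MemLp g 2 (volume.restrict (cyl T Ω)))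
    (hy : IsForwardSol ε a μ T Ω f y) (hp : IsBackwardSol ε a μ T Ω g p) :
    ∫ z in cyl T Ω, f z * p z = ∫ z in cyl T Ω, g z * y z := by
  obtain ⟨Dy, hyD, hy⟩ := hy
  obtain ⟨Dp, hpD, hp⟩ := hp
  have hF := hc.memLp_forwardJet ε hf hyD.memLp_grad
  have hG := hc.memLp_backwardJet ε hg hpD.memLp hpD.memLp_grad
  have key := integral_inner_jet_eq hyD hpD hF hG
    (fun φ hφ => by
      filter_upwards [(ae_restrict_iff' measurableSet_Ioo).1 (hy φ hφ)] with t h1 ht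
      rw [← integral_mul_test_sub (ε := ε)
        (B := fun z => formIntegrand a μ z (Dy z) (φ z.2) (gradient φ z.2)) hf hF hφ
        (fun z => inner_forwardJet ..) ht.1.le le_rfl ht.2.le, ← h1 ht]
      simp only [form, formIntegrand, add_sub_cancel_right])
    (fun φ hφ => by
      filter_upwards [(ae_restrict_iff' measurableSet_Ioo).1 (hp φ hφ)] with t h1 ht
      rw [← integral_mul_test_sub (ε := ε)
        (B := fun z => formIntegrand a μ z (gradient φ z.2) (p z) (Dp z)) hg hG hφ
        (fun z => inner_backwardJet ..) ht.2.le ht.1.le le_rfl, ← h1 ht]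
      simp only [form, formIntegrand, add_sub_cancel_right])
  have h1 := integrable_inner_of_memLp hF (memLp_jet hpD.memLp hpD.memLp_grad)
  have h2 := integrable_inner_of_memLp hG (memLp_jet hyD.memLp hyD.memLp_grad)
  have h3 : Integrable (fun z => f z * p z) (volume.restrict (cyl T Ω)) :=
    hf.integrable_mul hpD.memLp
  have h4 : Integrable (fun z => g z * y z) (volume.restrict (cyl T Ω)) :=
    hg.integrable_mul hyD.memLp
  -- Both integrands equal ε times the same form, evaluated at the gradient of `y` and the jet of
  -- `p`; this is where the two operators are adjoint.
  have h5 : ∫ z in cyl T Ω, (f z * p z - inner ℝ (forwardJet ε a μ f Dy z) (jet (p z) (Dp z))) =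
      ∫ z in cyl T Ω, (g z * y z -
        inner ℝ (backwardJet ε a μ g p Dp z) (jet (y z) (Dy z))) := by
    simp only [inner_forwardJet, inner_backwardJet, sub_sub_cancel]
  rw [integral_sub h3 h1, integral_sub h4 h2, key] at h5
  linarith

end Duality

/-! ### Controls and the expansion of the cost. -/

theorem measurableSet_spaceStrip {S : Set (Space d)} (hS : MeasurableSet S) :
    MeasurableSet {z : ℝ × Space d | z.2 ∈ S} :=
  measurable_snd hS

theorem restrict_cyl_restrict (T : ℝ) {S Ω : Set (Space d)} (hS : MeasurableSet S) (hSΩ : S ⊆ Ω) :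
    ((volume : Measure (ℝ × Space d)).restrict (cyl T Ω)).restrict
      {z : ℝ × Space d | z.2 ∈ S} = volume.restrict (cyl T S) := by
  rw [Measure.restrict_restrict (measurableSet_spaceStrip hS)]
  congr 1
  ext z
  simp only [cyl, mem_inter_iff, mem_ofPred_eq, mem_prod]
  exact ⟨fun h => ⟨h.2.1, h.1⟩, fun h => ⟨h.2, h.1, hSΩ h.2⟩⟩

theorem memLp_cut {T : ℝ} {S Ω : Set (Space d)} (hS : MeasurableSet S) (hSΩ : S ⊆ Ω)
    {u : ℝ × Space d → ℝ} (hu : MemLp u 2 (volume.restrict (cyl T S))) :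
    MemLp (cut S u) 2 (volume.restrict (cyl T Ω)) := by
  rw [cut, memLp_indicator_iff_restrict (measurableSet_spaceStrip hS), restrict_cyl_restrict T hS hSΩ]
  exact hu

theorem cyl_mono (T : ℝ) {S Ω : Set (Space d)} (h : S ⊆ Ω) : cyl T S ⊆ cyl T Ω :=
  prod_mono_right h

theorem memLp_cyl_mono {V : Type*} [NormedAddCommGroup V] {T : ℝ} {S Ω : Set (Space d)}
    (h : S ⊆ Ω) {u : ℝ × Space d → V} (hu : MemLp u 2 (volume.restrict (cyl T Ω))) :
    MemLp u 2 (volume.restrict (cyl T S)) :=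
  hu.mono_measure (Measure.restrict_mono (cyl_mono T h) le_rfl)

theorem integral_sq_eq_add {α : Type*} {mα : MeasurableSpace α} {ν : Measure α} {v w : α → ℝ}
    (hv : MemLp v 2 ν) (hw : MemLp w 2 ν) :
    ∫ z, v z ^ 2 ∂ν =
      ∫ z, w z ^ 2 ∂ν + ∫ z, (v z - w z) ^ 2 ∂ν + 2 * ∫ z, (v z - w z) * w z ∂ν := by
  have h1 : Integrable (fun z => (v z - w z) ^ 2) ν := (hv.sub hw).integrable_sq
  have h2 : Integrable (fun z => (v z - w z) * w z) ν := (hv.sub hw).integrable_mul hw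
  have h3 : Integrable (fun z => w z ^ 2 + (v z - w z) ^ 2) ν := hw.integrable_sq.add h1
  rw [← integral_const_mul, ← integral_add hw.integrable_sq h1,
    ← integral_add h3 (h2.const_mul 2)]
  exact integral_congr_ae (ae_of_all _ fun z => by ring)

/-- The second-order expansion of the cost at a control that satisfies the optimality system. -/
theorem costJ2_eq_add {ε β T : ℝ} {Ω U : Set (Space d)}
    {a : ℝ → Space d → Matrix (Fin d) (Fin d) ℝ} {μ : ℝ → Space d → Space d}
    (hc : BoundedCoeff a μ T Ω) (hΩ : MeasurableSet Ω) (hUΩ : U ⊆ Ω)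
    {yref y p f y' f' : ℝ × Space d → ℝ}
    (hyref : MemLp yref 2 (volume.restrict (cyl T Ω)))
    (hf : MemLp f 2 (volume.restrict (cyl T Ω))) (hf' : MemLp f' 2 (volume.restrict (cyl T Ω)))
    (hy : IsForwardSol ε a μ T Ω f y) (hy' : IsForwardSol ε a μ T Ω f' y')
    (hp : IsBackwardSol ε a μ T Ω (fun z => y z - yref z) p)
    (hopt : ∀ z, (f' z - f z) * (β * f z + p z) = 0)
    (hsupp : ∀ z, z.2 ∉ U → f' z - f z = 0) :
    costJ2 β T Ω U yref y' f' = costJ2 β T Ω U yref y f +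
      ((1 / 2) * (∫ z in cyl T Ω, (y' z - y z) ^ 2) +
        (β / 2) * ∫ z in cyl T U, (f' z - f z) ^ 2) := by
  have hyL : MemLp y 2 (volume.restrict (cyl T Ω)) := by
    obtain ⟨Dy, h, -⟩ := hy
    exact h.memLp
  have hyL' : MemLp y' 2 (volume.restrict (cyl T Ω)) := by
    obtain ⟨Dy, h, -⟩ := hy'
    exact h.memLp
  have hpL : MemLp p 2 (volume.restrict (cyl T Ω)) := by
    obtain ⟨Dp, h, -⟩ := hp
    exact h.memLp
  have hg : MemLp (fun z => y z - yref z) 2 (volume.restrict (cyl T Ω)) := hyL.sub hyref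
  have d1 := integral_source_mul_eq hc hf hg hy hp
  have d2 := integral_source_mul_eq hc hf' hg hy' hp
  -- The difference of the two dualities `d1` and `d2`, which share the same adjoint state.
  have e1 : ∫ z in cyl T Ω, (f' z - f z) * p z =
      ∫ z in cyl T Ω, (y' z - y z) * (y z - yref z) := by
    have h1 : ∫ z in cyl T Ω, (f' z - f z) * p z =
        (∫ z in cyl T Ω, f' z * p z) - ∫ z in cyl T Ω, f z * p z := by
      simp_rw [sub_mul]
      exact integral_sub (hf'.integrable_mul hpL) (hf.integrable_mul hpL)
    have h2 : ∫ z in cyl T Ω, (y' z - y z) * (y z - yref z) =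
        (∫ z in cyl T Ω, (y z - yref z) * y' z) - ∫ z in cyl T Ω, (y z - yref z) * y z := by
      refine Eq.trans (integral_congr_ae (ae_of_all _ fun z => ?_))
        (integral_sub (hg.integrable_mul hyL') (hg.integrable_mul hyL))
      simp only
      ring
    rw [h1, h2, d1, d2]
  -- By `hsupp` the integral over U extends to Ω, and `hopt` trades βf for -p. Together with `e1`
  -- this cancels the first-order term.
  have e2 : β * ∫ z in cyl T U, (f' z - f z) * f z =
      -∫ z in cyl T Ω, (f' z - f z) * p z := by
    rw [← setIntegral_eq_of_subset_of_forall_sdiff_eq_zero (measurableSet_cyl hΩ) (cyl_mono T hUΩ)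
      fun z hz => by
        rw [hsupp z fun hzU => hz.2 ⟨hz.1.1, hzU⟩, zero_mul],
      ← integral_const_mul, ← integral_neg]
    exact integral_congr_ae (ae_of_all _ fun z => by
      have := hopt z
      simp only
      linarith)
  have q1 := integral_sq_eq_add (hyL'.sub hyref) hg
  have q2 := integral_sq_eq_add (memLp_cyl_mono hUΩ hf') (memLp_cyl_mono hUΩ hf)
  simp only [Pi.sub_apply, sub_sub_sub_cancel_right] at q1
  rw [costJ2, costJ2, q1, q2]
  linear_combination e2 - e1

theorem control_feedback_eq {β : ℝ} {U₁ U₂ : Set (Space d)} (u₁ p : ℝ × Space d → ℝ) :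
    control U₁ U₂ u₁ (fun z => -(1 / β) * cut U₂ p z) =
      fun z => cut U₁ u₁ z - (1 / β) * cut U₂ p z := by
  funext z
  by_cases hz : z.2 ∈ U₂
  · simp [control, cut, hz, sub_eq_add_neg]
  · simp [control, cut, hz]

theorem control_sub_control {U₁ U₂ : Set (Space d)} (u₁ u₂ v₂ : ℝ × Space d → ℝ)
    (z : ℝ × Space d) :
    control U₁ U₂ u₁ v₂ z - control U₁ U₂ u₁ u₂ z = cut U₂ (fun z => v₂ z - u₂ z) z := by
  by_cases hz : z.2 ∈ U₂ <;> simp [control, cut, hz]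

end Follower

end

/-! ### Optimality and uniqueness of the feedback control. -/

theorem proposition1 {d : ℕ}
    -- time horizon, cost weight, spatial domain
    (T β : ℝ) (hT : 0 < T) (hβ : 0 < β)
    (Ω : Set (Follower.Space d)) (hΩ : IsOpen Ω) (hΩb : Bornology.IsBounded Ω)
    -- the control region and its partition between leader and follower
    (U U₁ U₂ : Set (Follower.Space d)) (hU : IsOpen U) (hUΩ : U ⊆ Ω)
    (hU₁ : IsOpen U₁) (hU₂ : IsOpen U₂) (hU₁U : U₁ ⊆ U) (hU₂U : U₂ ⊆ U)
    (hdisj : Disjoint U₁ U₂) (hpart : volume (U \ (U₁ ∪ U₂)) = 0)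
    -- the coefficients of the operator: Lipschitz, symmetric, uniformly elliptic
    (a : ℝ → Follower.Space d → Matrix (Fin d) (Fin d) ℝ)
    (μ : ℝ → Follower.Space d → Follower.Space d)
    (ha_lip : ∀ i j, ∃ K, LipschitzOnWith K
      (fun z : ℝ × Follower.Space d => a z.1 z.2 i j) (Ici 0 ×ˢ univ))
    (hμ_lip : ∃ K, LipschitzOnWith K
      (fun z : ℝ × Follower.Space d => μ z.1 z.2) (Ici 0 ×ˢ univ))
    (ha_symm : ∀ t, 0 ≤ t → ∀ x, (a t x).IsSymm)
    (ha_ell : ∃ c : ℝ, 0 < c ∧ ∀ t, 0 ≤ t → ∀ x,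
      (a t x - c • (1 : Matrix (Fin d) (Fin d) ℝ)).PosSemidef)
    -- the sign in front of the operator
    (ε : ℝ) (hε : ε = 1 ∨ ε = -1)
    -- the reference trajectory and the leader's control
    (yref : ℝ × Follower.Space d → ℝ)
    (hyref : MemLp yref 2 (volume.restrict (Follower.cyl T Ω)))
    (u₁ : ℝ × Follower.Space d → ℝ)
    (hu₁ : MemLp u₁ 2 (volume.restrict (Follower.cyl T U₁)))
    -- the coupled system has a solution, and only one
    (y p : ℝ × Follower.Space d → ℝ)
    (hsol : Follower.IsCoupledSol ε a μ β T Ω U₁ U₂ yref u₁ y p)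
    (huniq : ∀ y' p' : ℝ × Follower.Space d → ℝ,
      Follower.IsCoupledSol ε a μ β T Ω U₁ U₂ yref u₁ y' p' →
        y' =ᵐ[volume.restrict (Follower.cyl T Ω)] y ∧
        p' =ᵐ[volume.restrict (Follower.cyl T Ω)] p) :
    Follower.IsResponse ε a μ β T Ω U U₁ U₂ yref u₁
      (fun z => -(1 / β) * Follower.cut U₂ p z) ∧
    Follower.IsState ε a μ T Ω U₁ U₂ u₁ (fun z => -(1 / β) * Follower.cut U₂ p z) y ∧
    ∀ u₂ : ℝ × Follower.Space d → ℝ,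
      Follower.IsResponse ε a μ β T Ω U U₁ U₂ yref u₁ u₂ →
        u₂ =ᵐ[volume.restrict (Follower.cyl T U₂)]
          (fun z => -(1 / β) * Follower.cut U₂ p z) := by
  have hc := Follower.boundedCoeff_of_lipschitz (T := T) hΩ.measurableSet hΩb ha_lip hμ_lip
  obtain ⟨hfwd, hbwd⟩ := hsol
  have hpL : MemLp p 2 (volume.restrict (Follower.cyl T Ω)) := by
    obtain ⟨Dp, h, -⟩ := hbwd
    exact h.memLp
  have hstate : Follower.IsState ε a μ T Ω U₁ U₂ u₁ (fun z => -(1 / β) * Follower.cut U₂ p z) y := by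
    rw [Follower.IsState, Follower.control_feedback_eq]
    exact hfwd
  have hu : MemLp (fun z => -(1 / β) * Follower.cut U₂ p z) 2
      (volume.restrict (Follower.cyl T U₂)) :=
    (Follower.memLp_cut hU₂.measurableSet subset_rfl
      (Follower.memLp_cyl_mono (hU₂U.trans hUΩ) hpL)).const_mul _
  have hcontrol : ∀ v₂, MemLp v₂ 2 (volume.restrict (Follower.cyl T U₂)) →
      MemLp (Follower.control U₁ U₂ u₁ v₂) 2 (volume.restrict (Follower.cyl T Ω)) := fun v₂ hv₂ =>
    (Follower.memLp_cut hU₁.measurableSet (hU₁U.trans hUΩ) hu₁).add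
      (Follower.memLp_cut hU₂.measurableSet (hU₂U.trans hUΩ) hv₂)
  have hcost : ∀ v₂, MemLp v₂ 2 (volume.restrict (Follower.cyl T U₂)) → ∀ y',
      Follower.IsState ε a μ T Ω U₁ U₂ u₁ v₂ y' → _ := fun v₂ hv₂ y' hy' =>
    Follower.costJ2_eq_add (β := β) (U := U) hc hΩ.measurableSet hUΩ hyref (hcontrol _ hu)
      (hcontrol v₂ hv₂) hstate hy' hbwd
      (fun z => by
        rw [Follower.control_sub_control]
        by_cases hz : z.2 ∈ U₂
        -- Disjointness removes the leader's control on U₂, so the total control there is exactly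
        -- -p/β.
        · have hz₁ : z.2 ∉ U₁ := disjoint_right.1 hdisj hz
          have h : β * Follower.control U₁ U₂ u₁ (fun z => -(1 / β) * Follower.cut U₂ p z) z
              + p z = 0 := by
            simp only [Follower.control, Follower.cut, indicator, mem_ofPred_eq, hz, hz₁, if_true,
              if_false]
            field_simp
            ring
          rw [h, mul_zero]
        · simp [Follower.cut, hz])
      (fun z hz => by
        rw [Follower.control_sub_control]
        exact indicator_of_notMem (s := {z : ℝ × Follower.Space d | z.2 ∈ U₂})
          (fun h => hz (hU₂U h)) _)
  refine ⟨⟨hu, y, hstate, fun v₂ hv₂ y' hy' => ?_⟩, hstate, ?_⟩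
  · rw [hcost v₂ hv₂ y' hy']
    have h1 : 0 ≤ ∫ z in Follower.cyl T Ω, (y' z - y z) ^ 2 :=
      integral_nonneg fun z => sq_nonneg _
    have h2 : 0 ≤ ∫ z in Follower.cyl T U, (Follower.control U₁ U₂ u₁ v₂ z -
        Follower.control U₁ U₂ u₁ (fun z => -(1 / β) * Follower.cut U₂ p z) z) ^ 2 :=
      integral_nonneg fun z => sq_nonneg _
    exact le_add_of_nonneg_right (by positivity)
  · rintro u₂ ⟨hu₂, y', hy', hmin⟩
    have hle := hmin _ hu y hstate
    rw [hcost u₂ hu₂ y' hy'] at hle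
    have h1 : 0 ≤ ∫ z in Follower.cyl T Ω, (y' z - y z) ^ 2 :=
      integral_nonneg fun z => sq_nonneg _
    have h2 : 0 ≤ ∫ z in Follower.cyl T U, (Follower.control U₁ U₂ u₁ u₂ z -
        Follower.control U₁ U₂ u₁ (fun z => -(1 / β) * Follower.cut U₂ p z) z) ^ 2 :=
      integral_nonneg fun z => sq_nonneg _
    -- Another minimizer costs no more than the feedback control, so the nonnegative excess in the
    -- expansion is zero; β > 0 then isolates the control term.
    have h3 : ∫ z in Follower.cyl T U, (Follower.control U₁ U₂ u₁ u₂ z -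
        Follower.control U₁ U₂ u₁ (fun z => -(1 / β) * Follower.cut U₂ p z) z) ^ 2 = 0 := by
      refine le_antisymm ?_ h2
      by_contra hlt
      have := mul_pos (half_pos hβ) (not_le.1 hlt)
      linarith
    have h4 := (integral_eq_zero_iff_of_nonneg (fun z => sq_nonneg _)
      (Follower.memLp_cyl_mono hUΩ ((hcontrol u₂ hu₂).sub (hcontrol _ hu))).integrable_sq).1 h3
    have h5 := ae_mono (Measure.restrict_mono (Follower.cyl_mono T hU₂U) le_rfl) h4
    filter_upwards [h5, ae_restrict_mem (Follower.measurableSet_cyl hU₂.measurableSet)] with z hz hzU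
    have h6 := pow_eq_zero_iff (two_ne_zero) |>.1 hz
    rw [Pi.sub_apply, Follower.control_sub_control, Follower.cut, indicator_of_mem
      (show z ∈ {z : ℝ × Follower.Space d | z.2 ∈ U₂} from hzU.2)] at h6
    exact sub_eq_zero.1 h6
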